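/- For $k\in\mathbb C$ with $k^2\notin[1,\infty)$ let $$K(k)=\int_0^1\frac{dx}{\sqrt{(1-x^2)(1-k^2x^2)}},\qquad J(k)=\int_0^1\frac{k^2x^2\,dx}{\sqrt{(1-x^2)(1-k^2x^2)}}$$ (principal square root); both depend only on $k^2$. Let the polynomials $A_n(z)$ be given by $$(2n+1)A_n=2n(1+z)A_{n-1}-(2n-1)zA_{n-2}\quad(n\ge1),\qquad A_{-1}=0,\ A_0=1,$$ and put $\xi_n=n!/(3/2)_n$, where $(a)_n=a(a+1)\cdots(a+n-1)$. The Hermite Laurent biorthogonal polynomials are the monic polynomials $P_n=A_n/\xi_n$, their partners are the polynomials $\hat P_n(z)=\bigl(P_{n+1}(z)-P_n(z)\bigr)/z$, and $$h_n=\prod_{j=1}^n\frac{b_j}{d_j},\qquad b_j=-\frac{(j+1/2)^2}{j(j+1)},\quad d_j=-1.$$ For $z\in\mathbb C\setminus[0,\infty)$ write $z=k^2$, where $k=z^{1/2}=|z|^{1/2}e^{i\theta/2}$ and $\theta=\arg z\in(0,2\pi)$, so that $\operatorname{Im}k>0$, and let $$F_-(z)=-\frac{2J(k)}{k^2K(k)},\qquad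 F_+(z)=-\frac{2J(1/k)}{K(1/k)},\qquad w(z)=\frac{F_+(z)-F_-(z)}{2\pi i z}.$$ Then: 1. $K(k)\ne0$ and $K(1/k)\neq 0$ for $\operatorname{Im}k>0$, and for all $z\in\mathbb C\setminus[0,\infty)$ $$w(z)=\frac{1}{2z^{3/2}K(k)K(1/k)},\qquad z^{3/2}=k^3 .$$ 2. $w$ is integrable on the unit circle $C$ (positively oriented), and for all $n,m\ge0$ $$\int_C P_n(z)\hat P_m(1/z)\,w(z)\,dz=h_n\delta_{nm}.$$ 3. For $0<\theta<2\pi$ put $$\rho(\theta)=\frac{i}{2e^{i\theta/2}\,|K(e^{i\theta/2})|^2}.$$ Then $ie^{i\theta}w(e^{i\theta})=\rho(\theta)$ for $0<\theta<2\pi$, $\rho$ is integrable on $(0,2\pi)$, and for all $n,m\ge0$ $$\int_0^{2\pi}P_n(e^{i\theta})\,\hat P_m(e^{-i\theta})\,\rho(\theta)\,d\theta=h_n\delta_{nm}.$$ -/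

import Mathlib

namespace HermiteLBP

open Polynomial

noncomputable section

/-- Integrand `1 / √((1 - x²)(1 - k²x²))` of the complete elliptic integral of the first kind with
complex modulus `k`; the square root is the principal one. For real `x ∈ (0, 1)` and
`k² ∉ [1, ∞)` its argument avoids the cut `(-∞, 0]`. -/
def ellipticIntegrand (k : ℂ) (x : ℝ) : ℂ :=
  1 / ((1 - (x : ℂ) ^ 2) * (1 - k ^ 2 * (x : ℂ) ^ 2)) ^ (1 / 2 : ℂ)

/-- The complete elliptic integral of the first kind `K(k)`. -/
def ellipticK (k : ℂ) : ℂ := ∫ x in (0 : ℝ)..1, ellipticIntegrand k x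

/-- The complete elliptic integral `J(k) = ∫₀¹ k²x² dx / √((1 - x²)(1 - k²x²))`. -/
def ellipticJ (k : ℂ) : ℂ := ∫ x in (0 : ℝ)..1, k ^ 2 * (x : ℂ) ^ 2 * ellipticIntegrand k x

/-- Hermite's polynomials `A_n` in the variable `z = k²`:
`(2n+1) A_n = 2n (1+z) A_{n-1} - (2n-1) z A_{n-2}` with `A_{-1} = 0`, `A_0 = 1`. -/
def hermiteA : ℕ → ℂ[X]
  | 0 => 1
  | 1 => C (1 / 3) * (C 2 * (1 + X))
  | n + 2 => C (1 / (2 * (n : ℂ) + 5)) *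
      (C (2 * ((n : ℂ) + 2)) * (1 + X) * hermiteA (n + 1)
        - C (2 * (n : ℂ) + 3) * X * hermiteA n)

/-- `ξ_n = n! / (3/2)_n`, the leading coefficient of `A_n`. -/
def xi (n : ℕ) : ℂ := (n.factorial : ℂ) / ∏ j ∈ Finset.range n, (3 / 2 + (j : ℂ))

/-- The monic Hermite Laurent biorthogonal polynomials `P_n = A_n / ξ_n`. -/
def P (n : ℕ) : ℂ[X] := C (xi n)⁻¹ * hermiteA n

/-- The biorthogonal partners `(P_{n+1}(z) - P_n(z)) / z`; see `X_mul_Phat` below for the exactness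
of the division. -/
def Phat (n : ℕ) : ℂ[X] := (P (n + 1) - P n).divX

/-- The recurrence coefficients `b_n = -(n+1/2)² / (n(n+1))`, `n ≥ 1`. -/
def b (n : ℕ) : ℂ := -((n : ℂ) + 1 / 2) ^ 2 / ((n : ℂ) * ((n : ℂ) + 1))

/-- The recurrence coefficients `d_n = -1`. -/
def d (_n : ℕ) : ℂ := -1

/-- The normalization constants `h_n = ∏_{j=1}^n b_j / d_j`. -/
def h (n : ℕ) : ℂ := ∏ j ∈ Finset.Icc 1 n, b j / d j

/-- `F₋(z) = -2 J(k) / (k² K(k))` with `k² = z` (`K` and `J` depend on `k²` only). -/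
def Fminus (z : ℂ) : ℂ :=
  -(2 * ellipticJ (z ^ (1 / 2 : ℂ))) / (z * ellipticK (z ^ (1 / 2 : ℂ)))

/-- `F₊(z) = -2 J(1/k) / K(1/k)` with `k² = z`. -/
def Fplus (z : ℂ) : ℂ :=
  -(2 * ellipticJ (1 / z ^ (1 / 2 : ℂ))) / ellipticK (1 / z ^ (1 / 2 : ℂ))

/-- The weight function `w(z) = (F₊(z) - F₋(z)) / (2πiz)`. -/
def w (z : ℂ) : ℂ := (Fplus z - Fminus z) / (2 * (Real.pi : ℂ) * Complex.I * z)

/-- `ρ(θ) = i / (2 e^{iθ/2} |K(e^{iθ/2})|²)`. -/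
def rho (θ : ℝ) : ℂ :=
  Complex.I / (2 * Complex.exp (Complex.I * (θ : ℂ) / 2) *
    ((‖ellipticK (Complex.exp (Complex.I * (θ : ℂ) / 2))‖ ^ 2 : ℝ) : ℂ))

theorem xi_succ (n : ℕ) : xi (n + 1) = xi n * (((n : ℂ) + 1) / (3 / 2 + (n : ℂ))) := by
  simp only [xi, Finset.prod_range_succ, Nat.factorial_succ, Nat.cast_mul, Nat.cast_add,
    Nat.cast_one]
  rw [div_mul_div_comm]
  ring

theorem aux_ne (n a : ℕ) (ha : 0 < a) : (2 * (n : ℂ) + a) ≠ 0 := by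
  have : ((2 * n + a : ℕ) : ℂ) ≠ 0 := Nat.cast_ne_zero.mpr (by omega)
  simpa using this

theorem xi_ne_zero (n : ℕ) : xi n ≠ 0 := by
  induction n with
  | zero => simp [xi]
  | succ n ih =>
    rw [xi_succ]
    have h1 : (n : ℂ) + 1 ≠ 0 := Nat.cast_add_one_ne_zero n
    have h2 : (3 / 2 + (n : ℂ)) ≠ 0 := by
      intro h0
      apply aux_ne n 3 (by norm_num)
      push_cast
      linear_combination 2 * h0
    exact mul_ne_zero ih (div_ne_zero h1 h2)

/-- The three-term recurrence of the Laurent biorthogonal polynomials, first step. -/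
theorem P_rec_zero : P 1 + C (d 0) * P 0 = X * P 0 := by
  apply Polynomial.funext
  intro z
  simp [P, hermiteA, xi, d]
  ring

/-- The three-term recurrence `P_{n+1} + d_n P_n = z (P_n + b_n P_{n-1})`. -/
theorem P_rec (n : ℕ) :
    P (n + 2) + C (d (n + 1)) * P (n + 1) = X * (P (n + 1) + C (b (n + 1)) * P n) := by
  have hx := xi_ne_zero n
  have h1 : (n : ℂ) + 1 ≠ 0 := Nat.cast_add_one_ne_zero n
  have h2 : (n : ℂ) + 2 ≠ 0 := by
    have := Nat.cast_add_one_ne_zero (R := ℂ) (n + 1)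
    push_cast at this
    intro h0
    apply this
    linear_combination h0
  have h3 : 2 * (n : ℂ) + 3 ≠ 0 := by simpa using aux_ne n 3 (by norm_num)
  have h5 : 2 * (n : ℂ) + 5 ≠ 0 := by simpa using aux_ne n 5 (by norm_num)
  have e1 : (xi (n + 1))⁻¹ = (xi n)⁻¹ * ((2 * n + 3) / (2 * (n + 1))) := by
    rw [xi_succ]
    have : (3 / 2 + (n : ℂ)) = (2 * n + 3) / 2 := by ring
    rw [this]
    field_simp
  have e2 : (xi (n + 2))⁻¹ = (xi (n + 1))⁻¹ * ((2 * n + 5) / (2 * (n + 2))) := by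
    rw [xi_succ (n + 1)]
    push_cast
    have : (3 / 2 + ((n : ℂ) + 1)) = (2 * n + 5) / 2 := by ring
    have h' : (n : ℂ) + 1 + 1 = n + 2 := by ring
    rw [this, h']
    have := xi_ne_zero (n + 1)
    field_simp
  apply Polynomial.funext
  intro z
  simp only [P, hermiteA, b, d, eval_add, eval_mul, eval_sub, eval_C, eval_X, eval_one, e2, e1]
  push_cast
  have h' : (n : ℂ) + 1 + 1 ≠ 0 := by
    intro h0
    apply h2
    linear_combination h0
  field_simp
  ring

theorem P_coeff_zero (n : ℕ) : (P n).coeff 0 = 1 := by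
  have h0 : (P 0).coeff 0 = 1 := by simp [P, hermiteA, xi]
  induction n with
  | zero => exact h0
  | succ n ih =>
    cases n with
    | zero =>
      have := congrArg (fun p => coeff p 0) P_rec_zero
      simp [d, h0] at this
      linear_combination this
    | succ n =>
      have := congrArg (fun p => coeff p 0) (P_rec n)
      simp [d, ih] at this
      linear_combination this

theorem X_mul_Phat (n : ℕ) : X * Phat n = P (n + 1) - P n := by
  have := X_mul_divX_add (P (n + 1) - P n)
  rw [coeff_sub, P_coeff_zero, P_coeff_zero, sub_self, C_0, add_zero] at this
  exact this

end

end HermiteLBP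

/-! With `x = sin t` the elliptic integrals become moments: `K = I₀(k²)` and `J = k² I₁(k²)`, where
`I_n(m)` is `legI n m`. Integration by parts gives a three-term recurrence for the `I_n`. It has the
coefficients of Hermite's recurrence, so the quotients `R_n = 2 I_{n+1} / I₀` are remainders of a
two-point Padé approximation: `A_n(z) (R₀(z) - R₀(1/z)/z) = z^n R_n(z) - R_n(1/z)/z`
(`eval_hermiteA_mul`). The bracket is `2π i z w(z)`.

Dividing by `z^j` with `j ≤ n` and averaging over the circle, the mean value property leaves only
`R_n(0) = ξ_n h_n`, and only for `j = n`. The singularity of `I₀` at `z = 1` does no harm: `R_n` is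
bounded on the closed disc minus that point (`norm_R_le`). So `P_n` is orthogonal to lower powers of
`1/z`, which settles `m ≤ n`; the symmetry `z ↦ 1/z` of the density (`om_inv`) settles `m > n`.

The closed form of `w` is Legendre's relation. Its Wronskian-type combination `W` satisfies `W' =
W/(2m)`, so `W(k²)/k` is constant on the upper half plane; the constant comes from the lemniscatic
case `k = i` via Beta integrals. On the circle `K(1/k)` is the conjugate of `K(k)`, which gives `ρ`.
-/

namespace HermiteLBP

open Polynomial Set Filter Topology MeasureTheory

noncomputable section

/-! ### Moments: derivatives and contiguity relations -/

/-- `∫₀^{π/2} sin^{2n} t (1 - m sin² t)^p dt`. -/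
def sinIntegral (p : ℂ) (n : ℕ) (m : ℂ) : ℂ :=
  ∫ t in (0 : ℝ)..(Real.pi / 2),
    (Real.sin t : ℂ) ^ (2 * n) * (1 - m * (Real.sin t : ℂ) ^ 2) ^ p

/-- The moments `∫₀^{π/2} sin^{2n} t / √(1 - m sin² t) dt`. -/
abbrev legI (n : ℕ) (m : ℂ) : ℂ := sinIntegral (-1 / 2) n m

/-- The cut plane `ℂ ∖ [1, ∞)` of the parameter `m = k²`. -/
def cutPlane : Set ℂ := {m | 1 - m ∈ Complex.slitPlane}

theorem isOpen_cutPlane : IsOpen cutPlane :=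
  Complex.isOpen_slitPlane.preimage (by fun_prop)

/-- The point lies on the segment from `1` to `1 - m`, and the slit plane is star-shaped about `1`.
-/
theorem one_sub_mul_mem_slitPlane {m : ℂ} (hm : m ∈ cutPlane) {s : ℝ} (hs : s ∈ Icc (0 : ℝ) 1) :
    1 - m * (s : ℂ) ∈ Complex.slitPlane := by
  have := Complex.starConvex_one_slitPlane hm (a := 1 - s) (b := s) (by linarith [hs.2]) hs.1
    (by ring)
  convert this using 1
  simp
  ring

theorem one_sub_mul_sin_sq_mem {m : ℂ} (hm : m ∈ cutPlane) (t : ℝ) :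
    1 - m * (Real.sin t : ℂ) ^ 2 ∈ Complex.slitPlane := by
  have := one_sub_mul_mem_slitPlane hm (s := Real.sin t ^ 2) ⟨sq_nonneg _, Real.sin_sq_le_one t⟩
  simpa using this

theorem continuousOn_sinIntegrand (p : ℂ) (n : ℕ) :
    ContinuousOn (fun q : ℂ × ℝ => (Real.sin q.2 : ℂ) ^ (2 * n) *
      (1 - q.1 * (Real.sin q.2 : ℂ) ^ 2) ^ p) (cutPlane ×ˢ univ) := by
  apply ContinuousOn.mul
  · apply Continuous.continuousOn
    have : Continuous fun q : ℂ × ℝ => (Real.sin q.2 : ℂ) := by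
      exact Complex.continuous_ofReal.comp (Real.continuous_sin.comp continuous_snd)
    exact this.pow _
  · apply ContinuousOn.cpow_const
    · apply Continuous.continuousOn
      have : Continuous fun q : ℂ × ℝ => (Real.sin q.2 : ℂ) := by
        exact Complex.continuous_ofReal.comp (Real.continuous_sin.comp continuous_snd)
      exact continuous_const.sub (continuous_fst.mul (this.pow _))
    · rintro ⟨m, t⟩ ⟨hm, -⟩
      exact one_sub_mul_sin_sq_mem hm t

theorem continuous_sinIntegrand (p : ℂ) (n : ℕ) {m : ℂ} (hm : m ∈ cutPlane) :
    Continuous (fun t : ℝ => (Real.sin t : ℂ) ^ (2 * n) *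
      (1 - m * (Real.sin t : ℂ) ^ 2) ^ p) := by
  have := (continuousOn_sinIntegrand p n).comp_continuous (f := fun t : ℝ => (m, t))
    (by fun_prop) (fun t => ⟨hm, mem_univ _⟩)
  exact this

theorem hasDerivAt_sinIntegral (p : ℂ) (n : ℕ) {m : ℂ} (hm : m ∈ cutPlane) :
    HasDerivAt (sinIntegral p n) (-p * sinIntegral (p - 1) (n + 1) m) m := by
  obtain ⟨r, hr, hball⟩ := Metric.nhds_basis_closedBall.mem_iff.1 (isOpen_cutPlane.mem_nhds hm)
  have hcomp : IsCompact (Metric.closedBall m r ×ˢ Icc (0 : ℝ) (Real.pi / 2)) :=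
    (isCompact_closedBall m r).prod isCompact_Icc
  have hcont : ContinuousOn (fun q : ℂ × ℝ => -p * ((Real.sin q.2 : ℂ) ^ (2 * (n + 1)) *
      (1 - q.1 * (Real.sin q.2 : ℂ) ^ 2) ^ (p - 1)))
      (Metric.closedBall m r ×ˢ Icc (0 : ℝ) (Real.pi / 2)) :=
    continuousOn_const.mul ((continuousOn_sinIntegrand (p - 1) (n + 1)).mono
      (prod_mono hball (subset_univ _)))
  obtain ⟨B, hB⟩ := hcomp.exists_bound_of_continuousOn hcont
  have hpi : (0 : ℝ) ≤ Real.pi / 2 := by positivity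
  have key := intervalIntegral.hasDerivAt_integral_of_dominated_loc_of_deriv_le
    (μ := volume) (a := 0) (b := Real.pi / 2) (x₀ := m) (s := Metric.closedBall m r)
    (bound := fun _ => B)
    (F := fun (m : ℂ) (t : ℝ) => (Real.sin t : ℂ) ^ (2 * n) *
      (1 - m * (Real.sin t : ℂ) ^ 2) ^ p)
    (F' := fun (m : ℂ) (t : ℝ) => -p * ((Real.sin t : ℂ) ^ (2 * (n + 1)) *
      (1 - m * (Real.sin t : ℂ) ^ 2) ^ (p - 1)))
    (Metric.closedBall_mem_nhds m hr) ?_ ?_ ?_ ?_ ?_ ?_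
  · have h2 := key.2
    rw [intervalIntegral.integral_const_mul] at h2
    exact h2
  · filter_upwards [isOpen_cutPlane.mem_nhds hm] with x hx
    exact (continuous_sinIntegrand p n hx).aestronglyMeasurable
  · exact (continuous_sinIntegrand p n hm).intervalIntegrable _ _
  · exact (continuous_const.mul (continuous_sinIntegrand (p - 1) (n + 1) hm)).aestronglyMeasurable
  · refine ae_of_all _ fun t ht x hx => hB (x, t) ⟨hx, ?_⟩
    rw [uIoc_of_le hpi] at ht
    exact ⟨ht.1.le, ht.2⟩
  · exact intervalIntegrable_const
  · refine ae_of_all _ fun t ht x hx => ?_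
    have h1 : HasDerivAt (fun x : ℂ => 1 - x * (Real.sin t : ℂ) ^ 2) (-(Real.sin t : ℂ) ^ 2) x := by
      simpa using ((hasDerivAt_id x).mul_const ((Real.sin t : ℂ) ^ 2)).const_sub 1
    have h2 := (h1.cpow_const (c := p) (one_sub_mul_sin_sq_mem (hball hx) t)).const_mul
      ((Real.sin t : ℂ) ^ (2 * n))
    refine h2.congr_deriv ?_
    ring

theorem cpow_eq_mul_cpow_sub_one {u : ℂ} (hu : u ∈ Complex.slitPlane) (p : ℂ) :
    u ^ p = u * u ^ (p - 1) := by
  rw [Complex.cpow_sub _ _ (Complex.slitPlane_ne_zero hu), Complex.cpow_one]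
  field_simp [Complex.slitPlane_ne_zero hu]

/-- The contiguity relation in the exponent. -/
theorem sinIntegral_exponent (p : ℂ) (n : ℕ) {m : ℂ} (hm : m ∈ cutPlane) :
    sinIntegral p n m = sinIntegral (p - 1) n m - m * sinIntegral (p - 1) (n + 1) m := by
  simp only [sinIntegral]
  have hi (q : ℂ) (n : ℕ) (c : ℂ) : IntervalIntegrable (fun t : ℝ => c *
      ((Real.sin t : ℂ) ^ (2 * n) * (1 - m * (Real.sin t : ℂ) ^ 2) ^ q)) volume 0 (Real.pi / 2) :=
    (continuous_const.mul (continuous_sinIntegrand _ _ hm)).intervalIntegrable _ _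
  rw [← intervalIntegral.integral_const_mul, ← intervalIntegral.integral_sub
    (by simpa using hi (p - 1) n 1) (hi _ _ _)]
  congr 1
  ext t
  rw [cpow_eq_mul_cpow_sub_one (one_sub_mul_sin_sq_mem hm t) p]
  ring

/-- This primitive vanishes at `0` and at `π/2`, so integrating its derivative, rewritten in even
powers of `sin`, yields a linear relation between three consecutive moments. -/
theorem hasDerivAt_sin_mul_cos_mul_cpow (p : ℂ) (j : ℕ) {m : ℂ} (hm : m ∈ cutPlane) (t : ℝ) :
    HasDerivAt (fun t : ℝ => (Real.sin t : ℂ) ^ (2 * j + 1) * (Real.cos t : ℂ) *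
        (1 - m * (Real.sin t : ℂ) ^ 2) ^ p)
      ((2 * j + 1) * ((Real.sin t : ℂ) ^ (2 * j) * (1 - m * (Real.sin t : ℂ) ^ 2) ^ (p - 1))
        - (2 * j + 2 + m * (2 * j + 1 + 2 * p)) *
          ((Real.sin t : ℂ) ^ (2 * (j + 1)) * (1 - m * (Real.sin t : ℂ) ^ 2) ^ (p - 1))
        + m * (2 * j + 2 + 2 * p) *
          ((Real.sin t : ℂ) ^ (2 * (j + 2)) * (1 - m * (Real.sin t : ℂ) ^ 2) ^ (p - 1))) t := by
  have hs := (Real.hasDerivAt_sin t).ofReal_comp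
  have hc := (Real.hasDerivAt_cos t).ofReal_comp
  have hu : HasDerivAt (fun t : ℝ => 1 - m * (Real.sin t : ℂ) ^ 2)
      (-(m * (2 * Real.sin t * Real.cos t))) t := by
    have := ((hs.pow 2).const_mul m).const_sub 1
    refine this.congr_deriv ?_
    push_cast
    ring
  have hslit := one_sub_mul_sin_sq_mem hm t
  have hcp := HasDerivAt.scomp (h := fun t : ℝ => 1 - m * (Real.sin t : ℂ) ^ 2) t
    ((hasDerivAt_id (1 - m * (Real.sin t : ℂ) ^ 2)).cpow_const (c := p) hslit) hu
  have := ((hs.pow (2 * j + 1)).mul hc).mul hcp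
  have hcs : (Real.cos t : ℂ) ^ 2 = 1 - (Real.sin t : ℂ) ^ 2 := by
    have := Real.cos_sq' t
    exact_mod_cast this
  refine this.congr_deriv ?_
  simp only [id_eq, smul_eq_mul, Pi.mul_apply, Pi.pow_apply, Function.comp_apply,
    Nat.add_sub_cancel]
  rw [cpow_eq_mul_cpow_sub_one hslit p]
  push_cast [-Complex.ofReal_sin, -Complex.ofReal_cos]
  generalize (1 - m * (Real.sin t : ℂ) ^ 2) ^ (p - 1) = V
  generalize (Real.sin t : ℂ) = s at *
  generalize (Real.cos t : ℂ) = c at *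
  linear_combination ((2 * j + 1) * s ^ (2 * j) * (1 - m * s ^ 2) * V -
    2 * m * p * s ^ (2 * j + 2) * V) * hcs

theorem sinIntegral_contiguous (p : ℂ) (j : ℕ) {m : ℂ} (hm : m ∈ cutPlane) :
    (2 * j + 1) * sinIntegral (p - 1) j m
        - (2 * j + 2 + m * (2 * j + 1 + 2 * p)) * sinIntegral (p - 1) (j + 1) m
        + m * (2 * j + 2 + 2 * p) * sinIntegral (p - 1) (j + 2) m = 0 := by
  have hi (n : ℕ) (c : ℂ) : IntervalIntegrable (fun t : ℝ => c * ((Real.sin t : ℂ) ^ (2 * n) *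
      (1 - m * (Real.sin t : ℂ) ^ 2) ^ (p - 1))) volume 0 (Real.pi / 2) :=
    (continuous_const.mul (continuous_sinIntegrand _ _ hm)).intervalIntegrable _ _
  have := intervalIntegral.integral_eq_sub_of_hasDerivAt (a := 0) (b := Real.pi / 2)
    (fun t _ => hasDerivAt_sin_mul_cos_mul_cpow p j hm t) (((hi _ _).sub (hi _ _)).add (hi _ _))
  rw [intervalIntegral.integral_add ((hi _ _).sub (hi _ _)) (hi _ _),
    intervalIntegral.integral_sub (hi _ _) (hi _ _)] at this
  simp only [intervalIntegral.integral_const_mul] at this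
  simp only [sinIntegral]
  rw [this]
  simp

/-- The three-term recurrence of the moments. -/
theorem legI_rec (j : ℕ) {m : ℂ} (hm : m ∈ cutPlane) :
    (2 * j + 3) * (m * legI (j + 2) m) =
      2 * (j + 1) * (1 + m) * legI (j + 1) m - (2 * j + 1) * legI j m := by
  have := sinIntegral_contiguous (1 / 2) j hm
  have e : (1 / 2 - 1 : ℂ) = -1 / 2 := by norm_num
  rw [e] at this
  linear_combination this

/-- Differentiation produces moments of exponent `-3/2`; the contiguity relations bring them back to
exponent `-1/2`. Hence `I₀` and `I₁` satisfy a closed first-order linear system, as Legendre's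
relation requires. -/
theorem hasDerivAt_legI_zero {m : ℂ} (hm : m ∈ cutPlane) :
    HasDerivAt (legI 0) ((legI 0 m - legI 1 m) / (2 * (1 - m))) m := by
  have h0 := sinIntegral_exponent (-1 / 2) 0 hm
  have h1 := sinIntegral_exponent (-1 / 2) 1 hm
  have h2 := sinIntegral_contiguous (-1 / 2) 0 hm
  have hne : 1 - m ≠ 0 := Complex.slitPlane_ne_zero hm
  refine (hasDerivAt_sinIntegral (-1 / 2) 0 hm).congr_deriv ?_
  rw [eq_div_iff (mul_ne_zero two_ne_zero hne)]
  simp only [legI, zero_add] at *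
  push_cast at h2
  linear_combination -h2 - h0 + h1

theorem hasDerivAt_legI_one {m : ℂ} (hm : m ∈ cutPlane) (hm0 : m ≠ 0) :
    HasDerivAt (legI 1) (((legI 0 m - legI 1 m) / (2 * (1 - m)) - legI 1 m / 2) / m) m := by
  have h1 := sinIntegral_exponent (-1 / 2) 1 hm
  have h2 := (hasDerivAt_legI_zero hm).unique (hasDerivAt_sinIntegral (-1 / 2) 0 hm)
  refine (hasDerivAt_sinIntegral (-1 / 2) 1 hm).congr_deriv ?_
  rw [eq_div_iff hm0, h2]
  simp only [legI, zero_add] at *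
  linear_combination (1 / 2) * h1

/-! ### Substitution `x = sin^{k+1} t` and the elliptic integrals as moments -/

theorem image_sin_pow (k : ℕ) (hk : k ≠ 0) :
    (fun t => Real.sin t ^ k) '' Ioo 0 (Real.pi / 2) = Ioo 0 1 := by
  apply Subset.antisymm
  · rintro _ ⟨t, ht, rfl⟩
    have h0 : 0 < Real.sin t := Real.sin_pos_of_pos_of_lt_pi ht.1 (by linarith [ht.2, Real.pi_pos])
    have h1 : Real.sin t < 1 := by
      rw [← Real.sin_pi_div_two]
      exact Real.sin_lt_sin_of_lt_of_le_pi_div_two (by linarith [ht.1, Real.pi_pos]) le_rfl ht.2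
    exact ⟨pow_pos h0 k, pow_lt_one₀ h0.le h1 hk⟩
  · have := intermediate_value_Ioo (f := fun t => Real.sin t ^ k) (a := 0) (b := Real.pi / 2)
      (by positivity) (by fun_prop)
    simpa [hk] using this

theorem integral_comp_sin_pow (k : ℕ) (g : ℝ → ℂ) :
    ∫ x in (0 : ℝ)..1, g x = ∫ t in (0 : ℝ)..(Real.pi / 2),
      (((k + 1) * Real.sin t ^ k * Real.cos t : ℝ) : ℂ) * g (Real.sin t ^ (k + 1)) := by
  have hinj : InjOn (fun t => Real.sin t ^ (k + 1)) (Ioo 0 (Real.pi / 2)) := by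
    apply StrictMonoOn.injOn
    intro x hx y hy hxy
    refine pow_lt_pow_left₀ (Real.sin_lt_sin_of_lt_of_le_pi_div_two ?_ hy.2.le hxy)
      (Real.sin_nonneg_of_nonneg_of_le_pi hx.1.le ?_) k.succ_ne_zero
    · linarith [hx.1, Real.pi_pos]
    · linarith [hx.2, Real.pi_pos]
  have hd (t : ℝ) (ht : t ∈ Ioo 0 (Real.pi / 2)) :
      HasDerivWithinAt (fun t => Real.sin t ^ (k + 1)) ((k + 1) * Real.sin t ^ k * Real.cos t)
        (Ioo 0 (Real.pi / 2)) t := by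
    refine HasDerivAt.hasDerivWithinAt ?_
    have := (Real.hasDerivAt_sin t).fun_pow (k + 1)
    simpa using this
  have := integral_image_eq_integral_abs_deriv_smul measurableSet_Ioo hd hinj g
  rw [image_sin_pow _ k.succ_ne_zero] at this
  rw [intervalIntegral.integral_of_le zero_le_one,
    intervalIntegral.integral_of_le (by positivity), integral_Ioc_eq_integral_Ioo,
    integral_Ioc_eq_integral_Ioo, this]
  refine setIntegral_congr_fun measurableSet_Ioo fun t ht => ?_
  have h0 : 0 < Real.sin t := Real.sin_pos_of_pos_of_lt_pi ht.1 (by linarith [ht.2, Real.pi_pos])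
  have h1 : 0 < Real.cos t := Real.cos_pos_of_mem_Ioo ⟨by linarith [ht.1, Real.pi_pos], ht.2⟩
  rw [abs_of_nonneg (by positivity), Complex.real_smul]

theorem ofReal_mul_cpow {r : ℝ} (hr : 0 < r) (u p : ℂ) (hp : p ≠ 0) :
    ((r : ℂ) * u) ^ p = (r : ℂ) ^ p * u ^ p := by
  have hr' : (r : ℂ) ≠ 0 := Complex.ofReal_ne_zero.2 hr.ne'
  rcases eq_or_ne u 0 with rfl | hu
  · simp [hp]
  rw [Complex.cpow_def_of_ne_zero (mul_ne_zero hr' hu), Complex.cpow_def_of_ne_zero hr',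
    Complex.cpow_def_of_ne_zero hu, Complex.log_ofReal_mul hr hu, ← Complex.exp_add,
    Complex.ofReal_log hr.le]
  ring_nf

theorem sq_cpow_half {r : ℝ} (hr : 0 < r) : ((r : ℂ) ^ 2) ^ (1 / 2 : ℂ) = r := by
  have := Complex.ofReal_cpow (sq_nonneg r) (1 / 2)
  rw [← Real.sqrt_eq_rpow, Real.sqrt_sq hr.le] at this
  push_cast at this
  exact this.symm

/-- The factor `1 - x² = cos² t` is a positive real, so it leaves the principal root as `cos t` and
cancels against the Jacobian, whatever `k` is. -/
theorem cos_mul_ellipticIntegrand (k : ℂ) {t : ℝ} (ht : t ∈ Ioo 0 (Real.pi / 2)) :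
    (Real.cos t : ℂ) * ellipticIntegrand k (Real.sin t) =
      (1 - k ^ 2 * (Real.sin t : ℂ) ^ 2) ^ (-1 / 2 : ℂ) := by
  have h1 : 0 < Real.cos t := Real.cos_pos_of_mem_Ioo ⟨by linarith [ht.1, Real.pi_pos], ht.2⟩
  have hcs : 1 - (Real.sin t : ℂ) ^ 2 = ((Real.cos t ^ 2 : ℝ) : ℂ) := by
    have := Real.cos_sq' t
    rw [this]
    push_cast
    ring
  have hc : (Real.cos t : ℂ) ≠ 0 := Complex.ofReal_ne_zero.2 h1.ne'
  have e : (-1 / 2 : ℂ) = -(1 / 2) := by norm_num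
  rw [ellipticIntegrand, hcs, ofReal_mul_cpow (by positivity) _ _ (by norm_num),
    Complex.ofReal_pow, sq_cpow_half h1, e, Complex.cpow_neg]
  field_simp

theorem ellipticK_eq (k : ℂ) : ellipticK k = legI 0 (k ^ 2) := by
  rw [ellipticK, integral_comp_sin_pow 0, legI, sinIntegral]
  refine intervalIntegral.integral_congr_Ioo_of_le (by positivity) fun t ht => ?_
  simpa using cos_mul_ellipticIntegrand k ht

theorem ellipticJ_eq (k : ℂ) : ellipticJ k = k ^ 2 * legI 1 (k ^ 2) := by
  rw [ellipticJ, integral_comp_sin_pow 0, legI, sinIntegral, ← intervalIntegral.integral_const_mul]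
  refine intervalIntegral.integral_congr_Ioo_of_le (by positivity) fun t ht => ?_
  have := cos_mul_ellipticIntegrand k ht
  simp only [CharP.cast_eq_zero, zero_add, pow_zero, mul_one, one_mul, pow_one]
  linear_combination (k ^ 2 * (Real.sin t : ℂ) ^ 2) * this

/-! ### Positivity, non-vanishing and bounds -/

/-- Off the cut `|arg u| < π`, so the argument of `u^{-1/2}` is less than `π/2` in modulus. -/
theorem re_cpow_neg_half_pos {u : ℂ} (hu : u ∈ Complex.slitPlane) :
    0 < (u ^ (-1 / 2 : ℂ)).re := by
  rw [Complex.cpow_def_of_ne_zero (Complex.slitPlane_ne_zero hu), Complex.exp_re]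
  refine mul_pos (Real.exp_pos _) (Real.cos_pos_of_mem_Ioo ?_)
  have h1 := Complex.neg_pi_lt_arg u
  have h2 := (Complex.arg_le_pi u).lt_of_ne (Complex.mem_slitPlane_iff_arg.1 hu).1
  have e : (Complex.log u * (-1 / 2)).im = -Complex.arg u / 2 := by
    simp [Complex.mul_im, Complex.log_im]
    ring
  rw [e]
  constructor <;> linarith

/-- The square of `v = u^{-1/2}` is `1/u`, of non-negative real part, so `|Im v| ≤ Re v`. -/
theorem norm_cpow_neg_half_le {u : ℂ} (hu : u ∈ Complex.slitPlane) (hre : 0 ≤ u.re) :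
    ‖u ^ (-1 / 2 : ℂ)‖ ≤ 2 * (u ^ (-1 / 2 : ℂ)).re := by
  have hpos := re_cpow_neg_half_pos hu
  have hsq : u ^ (-1 / 2 : ℂ) * u ^ (-1 / 2 : ℂ) = u⁻¹ := by
    rw [← Complex.cpow_add _ _ (Complex.slitPlane_ne_zero hu), ← Complex.cpow_neg_one]
    norm_num
  have hre2 : 0 ≤ (u⁻¹).re := by
    rw [Complex.inv_re]
    exact div_nonneg hre (Complex.normSq_nonneg _)
  rw [← hsq, Complex.mul_re] at hre2
  set v := u ^ (-1 / 2 : ℂ)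
  have h2 : ‖v‖ ^ 2 = v.re * v.re + v.im * v.im := by
    rw [← Complex.normSq_eq_norm_sq, Complex.normSq_apply]
  nlinarith [norm_nonneg v]

theorem re_legI_zero (m : ℂ) (hm : m ∈ cutPlane) :
    (legI 0 m).re = ∫ t in (0 : ℝ)..(Real.pi / 2),
      ((1 - m * (Real.sin t : ℂ) ^ 2) ^ (-1 / 2 : ℂ)).re := by
  have := Complex.reCLM.intervalIntegral_comp_comm
    ((continuous_sinIntegrand (-1 / 2) 0 hm).intervalIntegrable (μ := volume) 0 (Real.pi / 2))
  simpa [legI, sinIntegral] using this.symm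

theorem re_legI_zero_pos {m : ℂ} (hm : m ∈ cutPlane) : 0 < (legI 0 m).re := by
  rw [re_legI_zero m hm]
  refine intervalIntegral.intervalIntegral_pos_of_pos_on ?_
    (fun t _ => re_cpow_neg_half_pos (one_sub_mul_sin_sq_mem hm t)) (by positivity)
  have := Complex.continuous_re.comp (continuous_sinIntegrand (-1 / 2) 0 hm)
  simpa [Function.comp_def] using this.intervalIntegrable (μ := volume) 0 (Real.pi / 2)

theorem legI_zero_ne_zero {m : ℂ} (hm : m ∈ cutPlane) : legI 0 m ≠ 0 := by
  intro h
  have := re_legI_zero_pos hm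
  simp [h] at this

/-- For `|m| ≤ 1` the integrand of `I₀` stays in a sector around the positive axis, so no
cancellation can make `I₀` small against the other moments. The bound is uniform up to `m = 1`. -/
theorem norm_legI_le (n : ℕ) {m : ℂ} (hm : m ∈ cutPlane) (hm1 : ‖m‖ ≤ 1) :
    ‖legI n m‖ ≤ 2 * ‖legI 0 m‖ := by
  have hint : IntervalIntegrable
      (fun t : ℝ => ((1 - m * (Real.sin t : ℂ) ^ 2) ^ (-1 / 2 : ℂ)).re) volume 0 (Real.pi / 2) := by
    have := Complex.continuous_re.comp (continuous_sinIntegrand (-1 / 2) 0 hm)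
    simpa [Function.comp_def] using this.intervalIntegrable (μ := volume) 0 (Real.pi / 2)
  calc ‖legI n m‖ ≤ ∫ t in (0 : ℝ)..(Real.pi / 2),
      2 * ((1 - m * (Real.sin t : ℂ) ^ 2) ^ (-1 / 2 : ℂ)).re := by
        refine intervalIntegral.norm_integral_le_of_norm_le (by positivity)
          (ae_of_all _ fun t _ => ?_) (hint.const_mul 2)
        rw [norm_mul]
        have hs : ‖(Real.sin t : ℂ)‖ ≤ 1 := by
          simpa only [Complex.norm_real, Real.norm_eq_abs] using Real.abs_sin_le_one t
        have h1 : ‖(Real.sin t : ℂ) ^ (2 * n)‖ ≤ 1 := by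
          rw [norm_pow]
          exact pow_le_one₀ (norm_nonneg _) hs
        refine (mul_le_of_le_one_left (norm_nonneg _) h1).trans
          (norm_cpow_neg_half_le (one_sub_mul_sin_sq_mem hm t) ?_)
        have h2 : ‖m * (Real.sin t : ℂ) ^ 2‖ ≤ 1 := by
          rw [norm_mul, norm_pow]
          exact mul_le_one₀ hm1 (by positivity) (pow_le_one₀ (norm_nonneg _) hs)
        have h3 := (Complex.re_le_norm _).trans h2
        simp only [Complex.sub_re, Complex.one_re]
        linarith
    _ = 2 * (legI 0 m).re := by
        rw [intervalIntegral.integral_const_mul, re_legI_zero m hm]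
    _ ≤ 2 * ‖legI 0 m‖ := by linarith [Complex.re_le_norm (legI 0 m)]

/-! ### Lemniscatic values and Legendre's relation -/

/-- Substitute `x = sin⁴ t`: then `1 - x = cos² t (1 + sin² t)`, which produces the parameter `-1`.
-/
theorem betaIntegral_eq_legI (n : ℕ) :
    Complex.betaIntegral ((2 * n + 1) / 4) (1 / 2) = 4 * legI n (-1) := by
  rw [Complex.betaIntegral, integral_comp_sin_pow 3, legI, sinIntegral,
    ← intervalIntegral.integral_const_mul]
  refine intervalIntegral.integral_congr_Ioo_of_le (by positivity) fun t ht => ?_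
  have h0 : 0 < Real.sin t := Real.sin_pos_of_pos_of_lt_pi ht.1 (by linarith [ht.2, Real.pi_pos])
  have h1 : 0 < Real.cos t := Real.cos_pos_of_mem_Ioo ⟨by linarith [ht.1, Real.pi_pos], ht.2⟩
  have e1 : ((Real.sin t ^ (3 + 1) : ℝ) : ℂ) ^ ((2 * n + 1) / 4 - 1 : ℂ) =
      (Real.sin t : ℂ) ^ (2 * n) / (Real.sin t : ℂ) ^ 3 := by
    have hs : (Real.sin t : ℂ) ≠ 0 := Complex.ofReal_ne_zero.2 h0.ne'
    have : ((2 * n + 1) / 4 - 1 : ℂ) = (((2 * n + 1) / 4 - 1 : ℝ) : ℂ) := by push_cast; ring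
    rw [this, ← Complex.ofReal_cpow (by positivity), ← Real.rpow_natCast, ← Real.rpow_mul h0.le]
    have e : ((3 + 1 : ℕ) : ℝ) * ((2 * n + 1) / 4 - 1) = ((2 * n : ℕ) : ℝ) - ((3 : ℕ) : ℝ) := by
      push_cast
      ring
    rw [e, Real.rpow_sub h0, Real.rpow_natCast, Real.rpow_natCast]
    push_cast
    rfl
  have e2 : 1 - ((Real.sin t ^ (3 + 1) : ℝ) : ℂ) =
      ((Real.cos t ^ 2 : ℝ) : ℂ) * (1 - (-1) * (Real.sin t : ℂ) ^ 2) := by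
    rw [Real.cos_sq']
    push_cast
    ring
  have e3 : (1 / 2 - 1 : ℂ) = -(1 / 2) := by norm_num
  have e4 : (-1 / 2 : ℂ) = -(1 / 2) := by norm_num
  have hs : (Real.sin t : ℂ) ≠ 0 := Complex.ofReal_ne_zero.2 h0.ne'
  have hc : (Real.cos t : ℂ) ≠ 0 := Complex.ofReal_ne_zero.2 h1.ne'
  rw [e1, e2, e3, e4, ofReal_mul_cpow (by positivity) _ _ (by norm_num), Complex.ofReal_pow,
    Complex.cpow_neg ((Real.cos t : ℂ) ^ 2), sq_cpow_half h1]
  push_cast [-Complex.ofReal_sin, -Complex.ofReal_cos]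
  field_simp
  norm_num
  ring

/-- The product of the two lemniscatic integrals. -/
theorem legI_zero_mul_legI_one_neg_one : legI 0 (-1) * legI 1 (-1) = Real.pi / 4 := by
  have b0 := betaIntegral_eq_legI 0
  have b1 := betaIntegral_eq_legI 1
  have g0 := Complex.Gamma_mul_Gamma_eq_betaIntegral (s := 1 / 4) (t := 1 / 2)
    (by norm_num) (by norm_num)
  have g1 := Complex.Gamma_mul_Gamma_eq_betaIntegral (s := 3 / 4) (t := 1 / 2)
    (by norm_num) (by norm_num)
  have g2 := Complex.Gamma_add_one (1 / 4) (by norm_num)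
  have n0 := Complex.Gamma_ne_zero_of_re_pos (s := 1 / 4) (by norm_num)
  have n1 := Complex.Gamma_ne_zero_of_re_pos (s := 3 / 4) (by norm_num)
  have hh : Complex.Gamma (1 / 2) * Complex.Gamma (1 / 2) = Real.pi := by
    rw [Complex.Gamma_one_half_eq, ← Complex.cpow_add _ _ (by exact_mod_cast Real.pi_ne_zero)]
    norm_num
  have a0 : ((2 * (0 : ℕ) + 1) / 4 : ℂ) = 1 / 4 := by norm_num
  have a1 : ((2 * (1 : ℕ) + 1) / 4 : ℂ) = 3 / 4 := by norm_num
  have a2 : (1 / 4 + 1 / 2 : ℂ) = 3 / 4 := by norm_num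
  have a3 : (3 / 4 + 1 / 2 : ℂ) = 1 / 4 + 1 := by norm_num
  rw [a0] at b0
  rw [a1] at b1
  rw [a2, b0] at g0
  rw [a3, b1, g2] at g1
  generalize Complex.Gamma (1 / 4) = x at *
  generalize Complex.Gamma (3 / 4) = y at *
  generalize Complex.Gamma (1 / 2) = g at *
  -- In the product of the two Gamma–Beta identities `Γ(1/4) Γ(3/4)` occurs on both sides and
  -- cancels; only `Γ(1/2)² = π` is evaluated.
  have : (x * y) * (legI 0 (-1) * legI 1 (-1) - Real.pi / 4) = 0 := by
    rw [← hh]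
    linear_combination (-1 / 4) * legI 1 (-1) * x * g0 - (1 / 4) * g * x * g1
  rcases mul_eq_zero.1 this with h | h
  · exact absurd h (mul_ne_zero n0 n1)
  · linear_combination h

theorem sq_mem_cutPlane {k : ℂ} (hk : k.im ≠ 0) : k ^ 2 ∈ cutPlane := by
  rw [cutPlane, mem_ofPred_eq, Complex.mem_slitPlane_iff]
  rcases eq_or_ne k.re 0 with h | h
  · left
    simp only [sq, Complex.sub_re, Complex.one_re, Complex.mul_re, h]
    nlinarith [mul_self_nonneg k.im]
  · right
    have : (1 - k ^ 2).im = -2 * (k.re * k.im) := by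
      simp only [sq, Complex.sub_im, Complex.one_im, Complex.mul_im]
      ring
    rw [this]
    exact mul_ne_zero (by norm_num) (mul_ne_zero h hk)

theorem inv_sq_mem_cutPlane {k : ℂ} (hk : k.im ≠ 0) : (k ^ 2)⁻¹ ∈ cutPlane := by
  rw [← inv_pow]
  refine sq_mem_cutPlane ?_
  have hk0 : k ≠ 0 := by
    rintro rfl
    simp at hk
  rw [Complex.inv_im]
  exact div_ne_zero (neg_ne_zero.2 hk) (Complex.normSq_pos.2 hk0).ne'

theorem mem_cutPlane_of_norm_le_one {m : ℂ} (hm : ‖m‖ ≤ 1) (hm1 : m ≠ 1) : m ∈ cutPlane := by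
  rw [cutPlane, mem_ofPred_eq, Complex.mem_slitPlane_iff]
  by_contra! h
  simp only [Complex.sub_re, Complex.one_re, Complex.sub_im, Complex.one_im] at h
  apply hm1
  have h1 := Complex.re_le_norm m
  apply Complex.ext
  · simp only [Complex.one_re]
    linarith
  · simp only [Complex.one_im]
    linarith

/-- The Wronskian-type combination occurring in Legendre's relation. -/
theorem hasDerivAt_legendre {m : ℂ} (hm : m ∈ cutPlane) (hm' : m⁻¹ ∈ cutPlane) (hm0 : m ≠ 0) :
    HasDerivAt (fun m => m * legI 1 m * legI 0 m⁻¹ - legI 1 m⁻¹ * legI 0 m)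
      ((m * legI 1 m * legI 0 m⁻¹ - legI 1 m⁻¹ * legI 0 m) / (2 * m)) m := by
  have hinv := hasDerivAt_inv hm0
  have d0 := hasDerivAt_legI_zero hm
  have d1 := hasDerivAt_legI_one hm hm0
  have e0 := (hasDerivAt_legI_zero hm').comp m hinv
  have e1 := (hasDerivAt_legI_one hm' (inv_ne_zero hm0)).comp m hinv
  have h1 : 1 - m ≠ 0 := Complex.slitPlane_ne_zero hm
  have h2 : m - 1 ≠ 0 := by
    rw [← neg_ne_zero, neg_sub]
    exact h1
  have h3 : 1 - m⁻¹ = (m - 1) / m := by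
    field_simp
  refine ((((hasDerivAt_id m).mul d1).mul e0).sub (e1.mul d0)).congr_deriv ?_
  simp only [Function.comp_apply, id_eq, Pi.mul_apply]
  rw [h3]
  have h4 : m - 1 = -(1 - m) := by ring
  rw [h4]
  field_simp
  ring

/-- Legendre's relation. -/
theorem legendre_relation {k : ℂ} (hk : 0 < k.im) :
    k ^ 2 * legI 1 (k ^ 2) * legI 0 (k ^ 2)⁻¹ - legI 1 (k ^ 2)⁻¹ * legI 0 (k ^ 2) =
      Real.pi * Complex.I * k / 2 := by
  set W : ℂ → ℂ := fun m => m * legI 1 m * legI 0 m⁻¹ - legI 1 m⁻¹ * legI 0 m with hW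
  have hne {k : ℂ} (hk : 0 < k.im) : k ≠ 0 := by
    rintro rfl
    simp at hk
  -- `W' = W/(2m)` makes `W` a multiple of `m^{1/2}`; in the variable `k` that root is
  -- single-valued.
  have hd {k : ℂ} (hk : 0 < k.im) : HasDerivAt (fun k => W (k ^ 2) / k) 0 k := by
    have h0 := hne hk
    have h1 := (hasDerivAt_legendre (sq_mem_cutPlane hk.ne') (inv_sq_mem_cutPlane hk.ne')
      (pow_ne_zero 2 h0)).comp k (hasDerivAt_pow 2 k)
    refine (h1.div (hasDerivAt_id k) h0).congr_deriv ?_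
    simp only [Function.comp_apply, id_eq]
    field_simp
    ring
  have hopen : IsOpen {k : ℂ | 0 < k.im} := isOpen_lt continuous_const Complex.continuous_im
  have hconn : IsPreconnected {k : ℂ | 0 < k.im} := (convex_halfSpace_im_gt 0).isPreconnected
  -- At `k = i` both `k²` and `1/k²` equal `-1`, so `W = -2 I₀(-1) I₁(-1)` there.
  have hc := hopen.is_const_of_deriv_eq_zero hconn
    (f := fun k => W (k ^ 2) / k) (fun k hk => (hd hk).differentiableAt.differentiableWithinAt)
    (fun k hk => (hd hk).deriv) (x := k) (y := Complex.I) hk (by simp)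
  simp only [hW, Complex.I_sq, inv_neg, inv_one] at hc
  rw [div_eq_div_iff (hne hk) Complex.I_ne_zero] at hc
  have hp := legI_zero_mul_legI_one_neg_one
  linear_combination (-Complex.I) * hc + 2 * Complex.I * k * hp +
    (k ^ 2 * legI 1 (k ^ 2) * legI 0 (k ^ 2)⁻¹ - legI 1 (k ^ 2)⁻¹ * legI 0 (k ^ 2)) * Complex.I_sq

/-! ### Padé remainders and the weight -/

/-- The quotients `2 ∫ sin^{2n+2} / ∫ 1` that carry the remainders of the Padé approximation. -/
def R (n : ℕ) (z : ℂ) : ℂ := 2 * legI (n + 1) z / legI 0 z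

theorem R_rec (n : ℕ) {z : ℂ} (hz : z ∈ cutPlane) :
    (2 * n + 5) * (z * R (n + 2) z) =
      2 * (n + 2) * (1 + z) * R (n + 1) z - (2 * n + 3) * R n z := by
  have h0 := legI_zero_ne_zero hz
  have := legI_rec (n + 1) hz
  push_cast at this
  simp only [R]
  field_simp
  linear_combination this

theorem R_rec_zero {z : ℂ} (hz : z ∈ cutPlane) :
    3 * (z * R 1 z) = 2 * (1 + z) * R 0 z - 2 := by
  have h0 := legI_zero_ne_zero hz
  have := legI_rec 0 hz
  push_cast at this
  simp only [R]
  field_simp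
  linear_combination this

/-- The density `i z w(z)` in terms of the elliptic integrals. -/
def om (z : ℂ) : ℂ := (R 0 z - R 0 z⁻¹ / z) / (2 * Real.pi)

/-- This symmetry turns `P̂_m` tested against `P_n` into a difference of consecutive `P`'s when `m >
n`. -/
theorem om_inv {z : ℂ} (hz : z ≠ 0) : om z⁻¹ = -z * om z := by
  simp only [om, inv_inv]
  have := Real.pi_ne_zero
  field_simp
  ring

theorem cpow_half_sq (z : ℂ) : (z ^ (1 / 2 : ℂ)) ^ 2 = z := by
  have e : (1 / 2 : ℂ) = ((2 : ℕ) : ℂ)⁻¹ := by norm_num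
  rw [e, Complex.cpow_nat_inv_pow z two_ne_zero]

/-- `K` and `J` depend on `k²` only, so the principal root in `Fminus` and `Fplus` is as good as the
branch with `Im k > 0`, and every `z ≠ 0` is admissible. -/
theorem w_eq {z : ℂ} (hz : z ≠ 0) : w z * (Complex.I * z) = om z := by
  have hp : (Real.pi : ℂ) ≠ 0 := by exact_mod_cast Real.pi_ne_zero
  have e1 : Fminus z = -R 0 z := by
    rw [Fminus, ellipticJ_eq, ellipticK_eq, cpow_half_sq, R]
    rw [mul_left_comm, ← mul_neg, mul_div_mul_left _ _ hz, neg_div]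
  have e2 : Fplus z = -(R 0 z⁻¹ / z) := by
    rw [Fplus, ellipticJ_eq, ellipticK_eq, one_div_pow, cpow_half_sq, R, one_div]
    ring
  rw [w, e1, e2, om]
  field_simp [Complex.I_ne_zero]
  ring

theorem ne_zero_of_im_pos {k : ℂ} (hk : 0 < k.im) : k ≠ 0 := by
  rintro rfl
  simp at hk

theorem ellipticK_ne_zero {k : ℂ} (hk : 0 < k.im) :
    ellipticK k ≠ 0 ∧ ellipticK (1 / k) ≠ 0 := by
  rw [ellipticK_eq, ellipticK_eq, one_div_pow, one_div]
  exact ⟨legI_zero_ne_zero (sq_mem_cutPlane hk.ne'),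
    legI_zero_ne_zero (inv_sq_mem_cutPlane hk.ne')⟩

theorem w_sq {k : ℂ} (hk : 0 < k.im) :
    w (k ^ 2) = 1 / (2 * k ^ 3 * ellipticK k * ellipticK (1 / k)) := by
  have hk0 := ne_zero_of_im_pos hk
  have hp : (Real.pi : ℂ) ≠ 0 := by exact_mod_cast Real.pi_ne_zero
  have h1 := w_eq (pow_ne_zero 2 hk0)
  have h2 := legendre_relation hk
  have n0 := legI_zero_ne_zero (sq_mem_cutPlane hk.ne')
  have n1 := legI_zero_ne_zero (inv_sq_mem_cutPlane hk.ne')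
  rw [ellipticK_eq, ellipticK_eq, one_div_pow, one_div (k ^ 2)]
  have hI : Complex.I * k ^ 2 ≠ 0 := mul_ne_zero Complex.I_ne_zero (pow_ne_zero 2 hk0)
  refine mul_right_cancel₀ hI (h1.trans ?_)
  rw [om, R, R]
  simp only [zero_add]
  generalize legI 0 (k ^ 2)⁻¹ = x at *
  generalize legI 1 (k ^ 2)⁻¹ = y at *
  field_simp
  linear_combination 2 * h2

/-- Both `z^n R_n(z)` and `R_n(1/z)/z` obey the recurrence of `A_n`, except for the constant `-2` of
`R_rec_zero` in the first step. That constant is the same for `z` and `1/z` and cancels in the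
difference. -/
theorem eval_hermiteA_mul (n : ℕ) {z : ℂ} (hz0 : z ≠ 0) (hz : z ∈ cutPlane)
    (hz' : z⁻¹ ∈ cutPlane) :
    (hermiteA n).eval z * (R 0 z - R 0 z⁻¹ / z) = z ^ n * R n z - R n z⁻¹ / z := by
  induction n using Nat.twoStepInduction with
  | zero => simp [hermiteA]
  | one =>
    have h1 := R_rec_zero hz
    have h2 := R_rec_zero hz'
    simp only [hermiteA, eval_mul, eval_C, eval_add, eval_one, eval_X, pow_one]
    field_simp at h2 ⊢
    linear_combination h2 - z * h1
  | more n ih0 ih1 =>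
    have h1 := R_rec n hz
    have h2 := R_rec n hz'
    have h5 : 2 * (n : ℂ) + 5 ≠ 0 := by simpa using aux_ne n 5 (by norm_num)
    have e : (hermiteA (n + 2)).eval z = (1 / (2 * (n : ℂ) + 5)) *
      ((2 * ((n : ℂ) + 2)) * (1 + z) * (hermiteA (n + 1)).eval z
        - (2 * (n : ℂ) + 3) * z * (hermiteA n).eval z) := by
      simp [hermiteA]
    have key : (2 * (n : ℂ) + 5) * ((hermiteA (n + 2)).eval z * (R 0 z - R 0 z⁻¹ / z)) =
        (2 * (n : ℂ) + 5) * (z ^ (n + 2) * R (n + 2) z - R (n + 2) z⁻¹ / z) := by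
      have e' : (2 * (n : ℂ) + 5) * ((hermiteA (n + 2)).eval z * (R 0 z - R 0 z⁻¹ / z)) =
          (2 * ((n : ℂ) + 2)) * (1 + z) * ((hermiteA (n + 1)).eval z * (R 0 z - R 0 z⁻¹ / z))
          - (2 * (n : ℂ) + 3) * z * ((hermiteA n).eval z * (R 0 z - R 0 z⁻¹ / z)) := by
        rw [e]
        field_simp
      rw [e', ih0, ih1]
      have hzi : z * z⁻¹ = 1 := mul_inv_cancel₀ hz0
      simp only [div_eq_mul_inv]
      linear_combination (-z ^ (n + 1)) * h1 + h2 +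
        ((2 * (n : ℂ) + 3) * R n z⁻¹ - 2 * ((n : ℂ) + 2) * R (n + 1) z⁻¹) * hzi
    exact mul_left_cancel₀ h5 key

theorem eval_P_mul_om (n : ℕ) {z : ℂ} (hz0 : z ≠ 0) (hz : z ∈ cutPlane) (hz' : z⁻¹ ∈ cutPlane) :
    (P n).eval z * om z = (xi n)⁻¹ * (z ^ n * R n z - R n z⁻¹ * z⁻¹) / (2 * Real.pi) := by
  have := eval_hermiteA_mul n hz0 hz hz'
  simp only [P, om, eval_mul, eval_C]
  rw [← div_eq_mul_inv (R n z⁻¹), ← this]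
  ring

/-- At `z = 0` the recurrence loses its highest term and becomes two-term; its product solution is
the source of `h_n`. -/
theorem R_at_zero (n : ℕ) : R n 0 = xi n * h n := by
  have h0 : (0 : ℂ) ∈ cutPlane := by simp [cutPlane]
  induction n with
  | zero =>
    have := R_rec_zero h0
    simp [xi, h]
    linear_combination (-1 / 2) * this
  | succ n ih =>
    have := R_rec n h0
    have n1 : (n : ℂ) + 1 ≠ 0 := Nat.cast_add_one_ne_zero n
    have n2 : 2 * (n : ℂ) + 3 ≠ 0 := by simpa using aux_ne n 3 (by norm_num)
    have n3 : 2 * (n : ℂ) + 4 ≠ 0 := by simpa using aux_ne n 4 (by norm_num)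
    have n4 : (n : ℂ) + 1 + 1 ≠ 0 := by
      intro h
      apply n3
      linear_combination 2 * h
    have n5 : 3 / 2 + (n : ℂ) = (2 * n + 3) / 2 := by ring
    have hh : h (n + 1) = h n * (b (n + 1) / d (n + 1)) := by
      rw [h, h, Finset.prod_Icc_succ_top (by omega)]
    rw [xi_succ, hh, b, d, n5]
    have e : R (n + 1) 0 = (2 * n + 3) / (2 * n + 4) * R n 0 := by
      rw [div_mul_eq_mul_div, eq_div_iff n3]
      linear_combination -this
    rw [e, ih]
    push_cast
    have n6 : (2 * (n : ℂ) + 4) = 2 * (n + 1 + 1) := by ring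
    rw [n6]
    field_simp
    ring

theorem differentiableOn_R (n : ℕ) : DifferentiableOn ℂ (R n) cutPlane := fun _ hz =>
  (((hasDerivAt_sinIntegral _ _ hz).differentiableAt.const_mul 2).div
    (hasDerivAt_sinIntegral _ _ hz).differentiableAt
    (legI_zero_ne_zero hz)).differentiableWithinAt

theorem norm_R_le (n : ℕ) {z : ℂ} (hz : z ∈ cutPlane) (hz1 : ‖z‖ ≤ 1) : ‖R n z‖ ≤ 4 := by
  have := norm_legI_le (n + 1) hz hz1
  rw [R, norm_div, norm_mul, div_le_iff₀ (norm_pos_iff.2 (legI_zero_ne_zero hz))]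
  simp only [RCLike.norm_ofNat]
  linarith

theorem legI_conj (n : ℕ) {m : ℂ} (hm : m ∈ cutPlane) :
    legI n ((starRingEnd ℂ) m) = (starRingEnd ℂ) (legI n m) := by
  have := (Complex.conjCLE : ℂ →L[ℝ] ℂ).intervalIntegral_comp_comm
    ((continuous_sinIntegrand (-1 / 2) n hm).intervalIntegrable (μ := volume) 0 (Real.pi / 2))
  simp only [legI, sinIntegral]
  refine Eq.trans ?_ this
  congr 1
  ext t
  have h1 := (Complex.mem_slitPlane_iff_arg.1 (one_sub_mul_sin_sq_mem hm t)).1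
  have h2 := Complex.conj_cpow _ (-1 / 2) h1
  have e : (starRingEnd ℂ) (-1 / 2 : ℂ) = -1 / 2 := by
    have : (-1 / 2 : ℂ) = ((-1 / 2 : ℝ) : ℂ) := by norm_num
    rw [this, Complex.conj_ofReal]
  rw [e] at h2
  simp only [ContinuousLinearEquiv.coe_coe, Complex.conjCLE_apply, map_mul, map_pow,
    Complex.conj_ofReal]
  rw [← h2]
  simp only [map_sub, map_mul, map_pow, map_one, Complex.conj_ofReal]

/-! ### The unit circle and the mean value property -/

/-- The point `e^{iθ}` of the unit circle. -/
def unitPt (θ : ℝ) : ℂ := Complex.exp (Complex.I * (θ : ℂ))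

theorem continuous_unitPt : Continuous unitPt := by
  unfold unitPt
  fun_prop

theorem norm_unitPt (θ : ℝ) : ‖unitPt θ‖ = 1 := by
  rw [unitPt, mul_comm, Complex.norm_exp_ofReal_mul_I]

theorem unitPt_ne_zero (θ : ℝ) : unitPt θ ≠ 0 := Complex.exp_ne_zero _

theorem unitPt_inv (θ : ℝ) : (unitPt θ)⁻¹ = unitPt (2 * Real.pi - θ) := by
  rw [unitPt, unitPt, ← Complex.exp_neg, ← Complex.exp_periodic]
  congr 1
  push_cast
  ring

theorem unitPt_eq_sq (θ : ℝ) : unitPt θ = Complex.exp (Complex.I * (θ : ℂ) / 2) ^ 2 := by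
  rw [unitPt, ← Complex.exp_nat_mul]
  congr 1
  push_cast
  ring

theorem exp_half_im_pos {θ : ℝ} (h0 : 0 < θ) (h1 : θ < 2 * Real.pi) :
    0 < (Complex.exp (Complex.I * (θ : ℂ) / 2)).im := by
  have : Complex.I * (θ : ℂ) / 2 = ((θ / 2 : ℝ) : ℂ) * Complex.I := by
    push_cast
    ring
  rw [this, Complex.exp_ofReal_mul_I_im]
  exact Real.sin_pos_of_pos_of_lt_pi (by linarith) (by linarith)

theorem unitPt_mem_cutPlane {θ : ℝ} (h0 : 0 < θ) (h1 : θ < 2 * Real.pi) :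
    unitPt θ ∈ cutPlane := by
  rw [unitPt_eq_sq]
  exact sq_mem_cutPlane (exp_half_im_pos h0 h1).ne'

theorem unitPt_inv_mem_cutPlane {θ : ℝ} (h0 : 0 < θ) (h1 : θ < 2 * Real.pi) :
    (unitPt θ)⁻¹ ∈ cutPlane := by
  rw [unitPt_eq_sq]
  exact inv_sq_mem_cutPlane (exp_half_im_pos h0 h1).ne'

theorem integral_unitPt_inv (f : ℂ → ℂ) :
    ∫ θ in (0 : ℝ)..(2 * Real.pi), f (unitPt θ)⁻¹ =
      ∫ θ in (0 : ℝ)..(2 * Real.pi), f (unitPt θ) := by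
  simp only [unitPt_inv]
  simpa using intervalIntegral.integral_comp_sub_left (a := 0) (b := 2 * Real.pi)
    (fun θ => f (unitPt θ)) (2 * Real.pi)

section MeanValue

variable {S : ℂ → ℂ} {B : ℝ}

theorem intervalIntegrable_comp_unitPt (hS : DifferentiableOn ℂ S cutPlane)
    (hB : ∀ z ∈ cutPlane, ‖z‖ ≤ 1 → ‖S z‖ ≤ B) :
    IntervalIntegrable (fun θ => S (unitPt θ)) volume 0 (2 * Real.pi) := by
  rw [intervalIntegrable_iff, uIoc_of_le Real.two_pi_pos.le, integrableOn_Ioc_iff_integrableOn_Ioo]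
  refine Integrable.of_bound (C := B) ?_ ?_
  · refine ContinuousOn.aestronglyMeasurable (fun θ hθ => ?_) measurableSet_Ioo
    have := (hS.differentiableAt (isOpen_cutPlane.mem_nhds
      (unitPt_mem_cutPlane hθ.1 hθ.2))).continuousAt
    exact (this.comp continuous_unitPt.continuousAt).continuousWithinAt
  · filter_upwards [ae_restrict_mem measurableSet_Ioo] with θ hθ
    exact hB _ (unitPt_mem_cutPlane hθ.1 hθ.2) (norm_unitPt θ).le

/-- The mean value property on the unit circle, up to the boundary point `1`. -/
theorem integral_comp_unitPt (hS : DifferentiableOn ℂ S cutPlane)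
    (hB : ∀ z ∈ cutPlane, ‖z‖ ≤ 1 → ‖S z‖ ≤ B) :
    ∫ θ in (0 : ℝ)..(2 * Real.pi), S (unitPt θ) = 2 * Real.pi * S 0 := by
  have hnorm (r : ℝ) (hr : r ∈ Ioo (0 : ℝ) 1) (θ : ℝ) : ‖(r : ℂ) * unitPt θ‖ = r := by
    rw [norm_mul, norm_unitPt, mul_one, Complex.norm_real, Real.norm_of_nonneg hr.1.le]
  have hmem (r : ℝ) (hr : r ∈ Ioo (0 : ℝ) 1) (θ : ℝ) : (r : ℂ) * unitPt θ ∈ cutPlane := by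
    refine mem_cutPlane_of_norm_le_one ((hnorm r hr θ).le.trans hr.2.le) fun h => ?_
    have := hnorm r hr θ
    rw [h, norm_one] at this
    exact hr.2.ne this.symm
  have hev : ∀ᶠ r : ℝ in 𝓝[<] 1, r ∈ Ioo (0 : ℝ) 1 := Ioo_mem_nhdsLT zero_lt_one
  have hconst : ∀ᶠ r : ℝ in 𝓝[<] 1,
      ∫ θ in (0 : ℝ)..(2 * Real.pi), S ((r : ℂ) * unitPt θ) = 2 * Real.pi * S 0 := by
    filter_upwards [hev] with r hr
    have hd : DiffContOnCl ℂ S (Metric.ball 0 |r|) := by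
      refine (hS.mono fun z hz => ?_).diffContOnCl
      rw [closure_ball _ (abs_pos.2 hr.1.ne').ne', mem_closedBall_zero_iff,
        abs_of_pos hr.1] at hz
      refine mem_cutPlane_of_norm_le_one (hz.trans hr.2.le) ?_
      rintro rfl
      rw [norm_one] at hz
      exact absurd hr.2 (not_lt.2 hz)
    have := hd.circleAverage
    rw [Real.circleAverage_def, inv_smul_eq_iff₀ Real.two_pi_pos.ne', Complex.real_smul] at this
    simp only [circleMap, zero_add, mul_comm _ Complex.I] at this
    push_cast at this
    exact this
  -- Let `r → 1` by dominated convergence with the constant bound `B`; pointwise convergence is only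
  -- left open at `θ = 2π`, a null set.
  refine tendsto_nhds_unique ?_ (tendsto_const_nhds.congr' (hconst.mono fun _ h => h.symm))
  refine intervalIntegral.tendsto_integral_filter_of_dominated_convergence (fun _ => B) ?_ ?_
    intervalIntegrable_const ?_
  · filter_upwards [hev] with r hr
    refine Continuous.aestronglyMeasurable ?_
    exact hS.continuousOn.comp_continuous (continuous_const.mul continuous_unitPt) (hmem r hr)
  · filter_upwards [hev] with r hr
    exact ae_of_all _ fun θ _ => hB _ (hmem r hr θ) ((hnorm r hr θ).le.trans hr.2.le)
  · have hae : ∀ᵐ θ : ℝ, θ ≠ 2 * Real.pi := by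
      simp [ae_iff, measure_singleton]
    filter_upwards [hae] with θ hne hθ
    rw [uIoc_of_le Real.two_pi_pos.le] at hθ
    have hc := (hS.differentiableAt (isOpen_cutPlane.mem_nhds
      (unitPt_mem_cutPlane hθ.1 (hθ.2.lt_of_ne hne)))).continuousAt
    have hl : Tendsto (fun r : ℝ => (r : ℂ) * unitPt θ) (𝓝[<] 1) (𝓝 (unitPt θ)) := by
      have : Continuous fun r : ℝ => (r : ℂ) * unitPt θ := by fun_prop
      have h2 := (this.tendsto 1).mono_left (nhdsWithin_le_nhds (s := Iio 1))
      simpa using h2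
    exact hc.tendsto.comp hl

end MeanValue

/-! ### Biorthogonality -/

theorem differentiableOn_pow_mul_R (j n : ℕ) :
    DifferentiableOn ℂ (fun z => z ^ j * R n z) cutPlane :=
  (differentiable_pow j).differentiableOn.mul (differentiableOn_R n)

theorem norm_pow_mul_R_le (j n : ℕ) (z : ℂ) (hz : z ∈ cutPlane) (hz1 : ‖z‖ ≤ 1) :
    ‖z ^ j * R n z‖ ≤ 4 := by
  rw [norm_mul, norm_pow]
  exact (mul_le_of_le_one_left (norm_nonneg _) (pow_le_one₀ (norm_nonneg _) hz1)).trans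
    (norm_R_le n hz hz1)

theorem intervalIntegrable_pow_mul_R (j n : ℕ) :
    IntervalIntegrable (fun θ => unitPt θ ^ j * R n (unitPt θ)) volume 0 (2 * Real.pi) :=
  intervalIntegrable_comp_unitPt (differentiableOn_pow_mul_R j n) (norm_pow_mul_R_le j n)

theorem integral_pow_mul_R (j n : ℕ) :
    ∫ θ in (0 : ℝ)..(2 * Real.pi), unitPt θ ^ j * R n (unitPt θ) =
      2 * Real.pi * (0 ^ j * R n 0) :=
  integral_comp_unitPt (differentiableOn_pow_mul_R j n) (norm_pow_mul_R_le j n)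

theorem intervalIntegrable_inv_pow_mul_R (j n : ℕ) :
    IntervalIntegrable (fun θ => (unitPt θ)⁻¹ ^ j * R n (unitPt θ)⁻¹) volume 0 (2 * Real.pi) := by
  simp only [unitPt_inv]
  have := ((intervalIntegrable_pow_mul_R j n).comp_sub_left (2 * Real.pi)).symm
  simpa using this

theorem integral_inv_pow_mul_R (j n : ℕ) :
    ∫ θ in (0 : ℝ)..(2 * Real.pi), (unitPt θ)⁻¹ ^ j * R n (unitPt θ)⁻¹ =
      2 * Real.pi * (0 ^ j * R n 0) :=
  (integral_unitPt_inv fun z => z ^ j * R n z).trans (integral_pow_mul_R j n)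

theorem intervalIntegrable_om :
    IntervalIntegrable (fun θ => om (unitPt θ)) volume 0 (2 * Real.pi) := by
  have h0 := intervalIntegrable_pow_mul_R 0 0
  have h1 := intervalIntegrable_inv_pow_mul_R 1 0
  have := (h0.sub h1).div_const (2 * Real.pi : ℂ)
  refine this.congr_uIoo fun θ _ => ?_
  simp only [om, pow_zero, one_mul, pow_one]
  ring

/-- By the Padé identity the integrand is a combination of `z^{n-j} R_n(z)` and `(1/z)^{j+1}
R_n(1/z)`. The second has mean zero for every `j`, the first unless `j = n`. -/
theorem integral_P_mul_inv_pow (n j : ℕ) (hj : j ≤ n) :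
    ∫ θ in (0 : ℝ)..(2 * Real.pi), (P n).eval (unitPt θ) * (unitPt θ)⁻¹ ^ j * om (unitPt θ) =
      if j = n then h n else 0 := by
  have hp : (Real.pi : ℂ) ≠ 0 := by exact_mod_cast Real.pi_ne_zero
  have h1 : ∫ θ in (0 : ℝ)..(2 * Real.pi),
        (P n).eval (unitPt θ) * (unitPt θ)⁻¹ ^ j * om (unitPt θ) =
      ∫ θ in (0 : ℝ)..(2 * Real.pi), ((xi n)⁻¹ / (2 * Real.pi)) *
        (unitPt θ ^ (n - j) * R n (unitPt θ) - (unitPt θ)⁻¹ ^ (j + 1) * R n (unitPt θ)⁻¹) := by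
    refine intervalIntegral.integral_congr_Ioo_of_le Real.two_pi_pos.le fun θ hθ => ?_
    have h2 := eval_P_mul_om n (unitPt_ne_zero θ) (unitPt_mem_cutPlane hθ.1 hθ.2)
      (unitPt_inv_mem_cutPlane hθ.1 hθ.2)
    have h3 : unitPt θ ^ n * (unitPt θ)⁻¹ ^ j = unitPt θ ^ (n - j) := by
      rw [inv_pow, ← div_eq_mul_inv, pow_sub₀ _ (unitPt_ne_zero θ) hj, div_eq_mul_inv]
    rw [mul_right_comm, h2, ← h3]
    ring
  rw [h1, intervalIntegral.integral_const_mul, intervalIntegral.integral_sub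
    (intervalIntegrable_pow_mul_R _ _) (intervalIntegrable_inv_pow_mul_R _ _),
    integral_pow_mul_R, integral_inv_pow_mul_R, R_at_zero]
  have hx := xi_ne_zero n
  rcases hj.eq_or_lt with rfl | hlt
  · simp
    field_simp
  · have : n - j ≠ 0 := by omega
    simp [this, hlt.ne]

theorem intervalIntegrable_mul_om {f : ℝ → ℂ} (hf : Continuous f) :
    IntervalIntegrable (fun θ => f θ * om (unitPt θ)) volume 0 (2 * Real.pi) :=
  intervalIntegrable_om.continuousOn_mul hf.continuousOn

theorem continuous_unitPt_inv : Continuous fun θ => (unitPt θ)⁻¹ :=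
  continuous_unitPt.inv₀ unitPt_ne_zero

/-- `P n` is orthogonal to the polynomials in `1 / z` of lower degree. -/
theorem integral_P_mul_eval_inv (n : ℕ) (q : ℂ[X]) (hq : q.natDegree ≤ n) :
    ∫ θ in (0 : ℝ)..(2 * Real.pi), (P n).eval (unitPt θ) * q.eval (unitPt θ)⁻¹ * om (unitPt θ) =
      h n * q.coeff n := by
  have hc (j : ℕ) : IntervalIntegrable (fun θ => q.coeff j *
      ((P n).eval (unitPt θ) * (unitPt θ)⁻¹ ^ j * om (unitPt θ))) volume 0 (2 * Real.pi) :=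
    (intervalIntegrable_mul_om (((P n).continuous.comp continuous_unitPt).mul
      (continuous_unitPt_inv.pow j))).const_mul _
  have h1 (θ : ℝ) : (P n).eval (unitPt θ) * q.eval (unitPt θ)⁻¹ * om (unitPt θ) =
      ∑ j ∈ Finset.range (n + 1), q.coeff j *
        ((P n).eval (unitPt θ) * (unitPt θ)⁻¹ ^ j * om (unitPt θ)) := by
    rw [eval_eq_sum_range' (Nat.lt_succ_of_le hq), Finset.mul_sum, Finset.sum_mul]
    exact Finset.sum_congr rfl fun j _ => by ring
  simp only [h1]
  rw [intervalIntegral.integral_finsetSum fun j _ => hc j]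
  simp only [intervalIntegral.integral_const_mul]
  rw [Finset.sum_congr rfl fun j hj => by
    rw [integral_P_mul_inv_pow n j (Nat.lt_succ_iff.1 (Finset.mem_range.1 hj))]]
  simp [mul_comm]

theorem P_natDegree_le_coeff (n : ℕ) : (P n).natDegree ≤ n ∧ (P n).coeff n = 1 := by
  induction n using Nat.twoStepInduction with
  | zero => simp [P, hermiteA, xi]
  | one =>
    have h0 : P 0 = 1 := by simp [P, hermiteA, xi]
    have h1 : P 1 = X + C 1 := by
      have := P_rec_zero
      simp only [h0, d, mul_one, C_neg] at this
      linear_combination this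
    rw [h1]
    exact ⟨(natDegree_X_add_C 1).le, by simp [coeff_one]⟩
  | more n ih0 ih1 =>
    have h1 : P (n + 2) = P (n + 1) + X * P (n + 1) + X * (C (b (n + 1)) * P n) := by
      have := P_rec n
      simp only [d, C_neg, C_1] at this
      linear_combination this
    rw [h1]
    have hX (p : ℂ[X]) (k : ℕ) (hp : p.natDegree ≤ k) : (X * p).natDegree ≤ k + 1 := by
      refine natDegree_mul_le.trans ?_
      rw [natDegree_X]
      omega
    have hC : (C (b (n + 1)) * P n).natDegree ≤ n := (natDegree_C_mul_le _ _).trans ih0.1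
    constructor
    · refine natDegree_add_le_of_degree_le (natDegree_add_le_of_degree_le ?_ ?_) ?_
      · exact ih1.1.trans (by omega)
      · exact hX _ _ ih1.1
      · exact (hX _ _ hC).trans (by omega)
    · rw [coeff_add, coeff_add, coeff_X_mul, coeff_X_mul, ih1.2,
        coeff_eq_zero_of_natDegree_lt (lt_of_le_of_lt ih1.1 (by omega)),
        coeff_eq_zero_of_natDegree_lt (lt_of_le_of_lt hC (by omega))]
      ring

theorem Phat_natDegree_le (n : ℕ) : (Phat n).natDegree ≤ n := by
  rw [Phat, natDegree_divX_eq_natDegree_tsub_one]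
  have := natDegree_sub_le_of_le (P_natDegree_le_coeff (n + 1)).1
    ((P_natDegree_le_coeff n).1.trans n.le_succ)
  simp only [max_self] at this
  omega

theorem Phat_coeff (n : ℕ) : (Phat n).coeff n = 1 := by
  rw [Phat, coeff_divX, coeff_sub, (P_natDegree_le_coeff (n + 1)).2,
    coeff_eq_zero_of_natDegree_lt (Nat.lt_succ_of_le (P_natDegree_le_coeff n).1), sub_zero]

/-- Biorthogonality in terms of the density on the unit circle. -/
theorem integral_P_mul_Phat (n m : ℕ) :
    ∫ θ in (0 : ℝ)..(2 * Real.pi),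
      (P n).eval (unitPt θ) * (Phat m).eval (unitPt θ)⁻¹ * om (unitPt θ) =
      if n = m then h n else 0 := by
  rcases le_or_gt m n with hmn | hmn
  · rw [integral_P_mul_eval_inv n _ ((Phat_natDegree_le m).trans hmn)]
    rcases hmn.eq_or_lt with rfl | hlt
    · simp [Phat_coeff]
    · rw [coeff_eq_zero_of_natDegree_lt ((Phat_natDegree_le m).trans_lt hlt), if_neg hlt.ne',
        mul_zero]
  -- For `m > n` replace `z` by `1/z`: the factor `-z` from `om_inv` meets `P̂_m(z)`, and `z P̂_m =
  -- P_{m+1} - P_m`. Both terms are orthogonal to `P_n(1/z)`, whose degree in `1/z` is too low.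
  · rw [if_neg hmn.ne, ← integral_unitPt_inv fun z =>
      (P n).eval z * (Phat m).eval z⁻¹ * om z]
    have hi (k : ℕ) : IntervalIntegrable (fun θ => (P k).eval (unitPt θ) *
        (P n).eval (unitPt θ)⁻¹ * om (unitPt θ)) volume 0 (2 * Real.pi) :=
      intervalIntegrable_mul_om (((P k).continuous.comp continuous_unitPt).mul
        ((P n).continuous.comp continuous_unitPt_inv))
    have h0 (k : ℕ) (hk : n < k) := integral_P_mul_eval_inv k (P n)
      ((P_natDegree_le_coeff n).1.trans hk.le)
    have h1 : ∀ θ : ℝ, (P n).eval (unitPt θ)⁻¹ * (Phat m).eval (unitPt θ)⁻¹⁻¹ * om (unitPt θ)⁻¹ =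
        (P m).eval (unitPt θ) * (P n).eval (unitPt θ)⁻¹ * om (unitPt θ) -
        (P (m + 1)).eval (unitPt θ) * (P n).eval (unitPt θ)⁻¹ * om (unitPt θ) := fun θ => by
      have h2 := congrArg (eval (unitPt θ)) (X_mul_Phat m)
      rw [eval_mul, eval_X, eval_sub] at h2
      rw [inv_inv, om_inv (unitPt_ne_zero θ)]
      linear_combination (-(P n).eval (unitPt θ)⁻¹ * om (unitPt θ)) * h2
    simp only [h1]
    rw [intervalIntegral.integral_sub (hi m) (hi (m + 1)), h0 m hmn, h0 (m + 1) (by omega),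
      coeff_eq_zero_of_natDegree_lt ((P_natDegree_le_coeff n).1.trans_lt hmn),
      coeff_eq_zero_of_natDegree_lt ((P_natDegree_le_coeff n).1.trans_lt (hmn.trans m.lt_succ_self))]
    simp

/-! ### The density `ρ` and the final assembly -/

theorem circleMap_eq_unitPt (θ : ℝ) : circleMap 0 1 θ = unitPt θ := by
  simp [circleMap, unitPt, mul_comm]

/-- For `|k| = 1` one has `1/k = conj k`, hence `K(1/k) = conj K(k)`, and the product of the two in
the formula for `w` is `|K(k)|²`. -/
theorem om_unitPt_eq_rho {θ : ℝ} (h0 : 0 < θ) (h1 : θ < 2 * Real.pi) :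
    om (unitPt θ) = rho θ := by
  have hk := exp_half_im_pos h0 h1
  rw [← w_eq (unitPt_ne_zero θ), unitPt_eq_sq, w_sq hk, rho]
  have hnorm : ‖Complex.exp (Complex.I * (θ : ℂ) / 2)‖ = 1 := by
    have : Complex.I * (θ : ℂ) / 2 = ((θ / 2 : ℝ) : ℂ) * Complex.I := by
      push_cast
      ring
    rw [this, Complex.norm_exp_ofReal_mul_I]
  set k := Complex.exp (Complex.I * (θ : ℂ) / 2) with hkdef
  have hk0 : k ≠ 0 := Complex.exp_ne_zero _
  have hconj : ellipticK (1 / k) = (starRingEnd ℂ) (ellipticK k) := by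
    rw [ellipticK_eq, ellipticK_eq, ← legI_conj 0 (sq_mem_cutPlane hk.ne'), map_pow, one_div,
      Complex.inv_eq_conj hnorm]
  have hK := (ellipticK_ne_zero hk).1
  have hK' := (ellipticK_ne_zero hk).2
  have hm : ((‖ellipticK k‖ ^ 2 : ℝ) : ℂ) = ellipticK k * ellipticK (1 / k) := by
    rw [hconj, Complex.mul_conj, Complex.normSq_eq_norm_sq]
  rw [hm]
  generalize ellipticK (1 / k) = y at *
  field_simp

end

end HermiteLBP

theorem mainTheorem2 :
    -- the elliptic integrals do not vanish on the domain considered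
    (∀ k : ℂ, 0 < k.im → HermiteLBP.ellipticK k ≠ 0 ∧ HermiteLBP.ellipticK (1 / k) ≠ 0) ∧
    -- the weight function, with `z = k²` and `k = z^{1/2}`, `0 < arg z < 2π`
    (∀ k : ℂ, 0 < k.im →
      HermiteLBP.w (k ^ 2) =
        1 / (2 * k ^ 3 * HermiteLBP.ellipticK k * HermiteLBP.ellipticK (1 / k))) ∧
    -- biorthogonality as a contour integral over the unit circle
    CircleIntegrable HermiteLBP.w 0 1 ∧
    (∀ n m : ℕ,
      (∮ z in C(0, 1), (HermiteLBP.P n).eval z * (HermiteLBP.Phat m).eval (1 / z) *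
          HermiteLBP.w z) =
        if n = m then HermiteLBP.h n else 0) ∧
    -- the weight `ρ` is the density of `w(z) dz` in the angle `θ`
    (∀ θ : ℝ, 0 < θ → θ < 2 * Real.pi →
      HermiteLBP.w (Complex.exp (Complex.I * (θ : ℂ))) *
          (Complex.I * Complex.exp (Complex.I * (θ : ℂ))) =
        HermiteLBP.rho θ) ∧
    -- biorthogonality with respect to `ρ`
    IntervalIntegrable HermiteLBP.rho MeasureTheory.volume 0 (2 * Real.pi) ∧
    (∀ n m : ℕ,
      (∫ θ in (0 : ℝ)..(2 * Real.pi),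
          (HermiteLBP.P n).eval (Complex.exp (Complex.I * (θ : ℂ))) *
            (HermiteLBP.Phat m).eval (Complex.exp (-(Complex.I * (θ : ℂ)))) *
            HermiteLBP.rho θ) =
        if n = m then HermiteLBP.h n else 0) := by
  have hneg (θ : ℝ) : Complex.exp (-(Complex.I * (θ : ℂ))) = (HermiteLBP.unitPt θ)⁻¹ :=
    Complex.exp_neg _
  refine ⟨fun k hk => HermiteLBP.ellipticK_ne_zero hk, fun k hk => HermiteLBP.w_sq hk, ?_, ?_, ?_,
    ?_, ?_⟩
  · have hcont : Continuous fun θ => -Complex.I * (HermiteLBP.unitPt θ)⁻¹ :=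
      continuous_const.mul HermiteLBP.continuous_unitPt_inv
    refine (HermiteLBP.intervalIntegrable_mul_om hcont).congr_uIoo fun θ _ => ?_
    have hz := HermiteLBP.unitPt_ne_zero θ
    simp only [HermiteLBP.circleMap_eq_unitPt]
    rw [← HermiteLBP.w_eq hz]
    field_simp
    linear_combination (-HermiteLBP.w (HermiteLBP.unitPt θ)) * Complex.I_sq
  · intro n m
    rw [← HermiteLBP.integral_P_mul_Phat n m, circleIntegral]
    refine intervalIntegral.integral_congr fun θ _ => ?_
    simp only [deriv_circleMap, HermiteLBP.circleMap_eq_unitPt, smul_eq_mul, one_div]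
    rw [← HermiteLBP.w_eq (HermiteLBP.unitPt_ne_zero θ)]
    ring
  · intro θ h0 h1
    rw [← HermiteLBP.om_unitPt_eq_rho h0 h1, ← HermiteLBP.w_eq (HermiteLBP.unitPt_ne_zero θ)]
    rfl
  · refine HermiteLBP.intervalIntegrable_om.congr_uIoo fun θ hθ => ?_
    rw [Set.uIoo_of_le Real.two_pi_pos.le] at hθ
    exact HermiteLBP.om_unitPt_eq_rho hθ.1 hθ.2
  · intro n m
    rw [← HermiteLBP.integral_P_mul_Phat n m]
    -- At the endpoints `e^{iθ/2} = ±1` and `k² = 1` lies on the cut, so the densities are compared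
    -- on the open interval only.
    refine intervalIntegral.integral_congr_Ioo_of_le Real.two_pi_pos.le fun θ hθ => ?_
    simp only [hneg, HermiteLBP.om_unitPt_eq_rho hθ.1 hθ.2]
    rfl
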